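/- Let $S=k[x_1,\dots,x_n]$ be a polynomial ring over a field, let $M\subseteq S$ be a monomial ideal, and let $g_1,\dots,g_q$ be its minimal monomial generators. The Taylor resolution of $S/M$ has one basis element $e_s$, in homological degree $|s|$, for each subset $s\subseteq\{1,\dots,q\}$; the multidegree of $e_s$ is $\operatorname{lcm}(g_j : j\in s)$ (with $\operatorname{lcm}(\emptyset)=1$). Let $m$ be a monomial that occurs as the multidegree of a basis element of the Taylor resolution, and let $A$ be the set of those $g_j$ that divide $m$. A subset $B\subseteq A$ is called a *generator of $m$ in $A$* if $\operatorname{lcm}(B)=m$, and a *minimal generator of $m$ in $A$* if moreover no proper subset of $B$ is a generator of $m$ in $A$. Let $\mathscr F$ be the family of all minimal generators of $m$ in $A$. Suppose that $$A=\bigcup_{B\in\mathscr F}B$$ and that $\mathscr F$ is a dominant family of sets, i.e. a finite nonempty family of finite nonempty sets, none of which is contained in the union of the others. Then the number of basis elements of multidegree $m$ in the Taylor resolution (in all homological degrees together) is odd, and the minimal multigraded free resolution of $M$ contains at least one basis element of multidegree $m$. The latter holds whether "resolution of $M$" is understood as a resolution of the $S$-module $S/M$ or of the $S$-module $M$. Here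 a minimal multigraded free resolution is a resolution by finitely generated multigraded free modules $F_i$ with homogeneous bases and multidegree-preserving differentials $d_i\colon F_{i+1}\to F_i$ such that $d_i(F_{i+1})\subseteq(x_1,\dots,x_n)F_i$ for all $i\ge 0$. -/

import Mathlib

/- Throughout, a monomial in the variables `σ` is identified with its exponent vector
`a : σ →₀ ℕ`.  Divisibility of monomials is then `≤`, the lcm is `⊔`, and the monomial `1` is `0`. -/

/-- A dominant family of sets: a finite nonempty family of finite nonempty sets, none of which
is contained in the union of the others. -/
def IsDominantFamily {α : Type*} (𝓕 : Set (Finset α)) : Prop :=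
  𝓕.Finite ∧ 𝓕.Nonempty ∧ (∀ B ∈ 𝓕, B.Nonempty) ∧
    ∀ B ∈ 𝓕, ¬ ((B : Set α) ⊆ ⋃ C ∈ 𝓕 \ {B}, (C : Set α))

/-- `B` is a generator of the monomial `m` in the set of monomials `A`: a finite subset of `A` whose
lcm is `m` (the lcm of the empty set being `1`). -/
def IsGeneratorOf {σ : Type*} (A : Set (σ →₀ ℕ)) (m : σ →₀ ℕ) (B : Finset (σ →₀ ℕ)) : Prop :=
  (B : Set (σ →₀ ℕ)) ⊆ A ∧ B.sup id = m

/-- The family of all minimal generators of `m` in `A`: the generators of `m` in `A` none of whose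
proper subsets is a generator of `m` in `A`. -/
def minimalGenerators {σ : Type*} (A : Set (σ →₀ ℕ)) (m : σ →₀ ℕ) : Set (Finset (σ →₀ ℕ)) :=
  {B | IsGeneratorOf A m B ∧ ∀ C, C ⊂ B → ¬ IsGeneratorOf A m C}

/-- The ideal `M` is minimally generated by the monomials `g 0, …, g (q - 1)`: they generate `M`,
and none of them lies in the ideal generated by the others. -/
def IsMinimallyGeneratedBy {σ k : Type*} [Field k] (M : Ideal (MvPolynomial σ k)) {q : ℕ}
    (g : Fin q → σ →₀ ℕ) : Prop :=
  M = Ideal.span (Set.range fun j => MvPolynomial.monomial (g j) (1 : k)) ∧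
    ∀ j, MvPolynomial.monomial (g j) (1 : k) ∉
      Ideal.span ((fun i => MvPolynomial.monomial (g i) (1 : k)) '' {i | i ≠ j})

/-- A (nonnegatively graded) complex of finitely generated multigraded free modules over the
polynomial ring `S = k[σ]`, given with homogeneous bases: the `i`-th module is free on the finite
set `ι i`, the basis element `b` has multidegree `mdeg i b`, and the differentials are homogeneous
of multidegree `0`. -/
structure MultigradedFreeComplex (σ k : Type*) [Field k] where
  /-- the homogeneous basis in homological degree `i` -/
  ι : ℕ → Type
  finite : ∀ i, Finite (ι i)
  /-- the multidegrees of the basis elements -/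
  mdeg : ∀ i, ι i → σ →₀ ℕ
  /-- the differentials -/
  d : ∀ i, (ι (i + 1) →₀ MvPolynomial σ k) →ₗ[MvPolynomial σ k] (ι i →₀ MvPolynomial σ k)
  d_comp_d : ∀ i, d i ∘ₗ d (i + 1) = 0
  d_homogeneous : ∀ i b c, ∀ e ∈ (d i (Finsupp.single b 1) c).support,
    e + mdeg i c = mdeg (i + 1) b

namespace MultigradedFreeComplex

variable {σ k : Type*} [Field k]

/-- The set of basis elements of multidegree `m`, in all homological degrees. -/
def basisOfMultidegree (F : MultigradedFreeComplex σ k) (m : σ →₀ ℕ) : Set (Σ i, F.ι i) :=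
  {b | F.mdeg b.1 b.2 = m}

/-- `F` is a multigraded free resolution of the `S`-module `N`, whose multigraded components are
`𝒩 a`: for some homogeneous augmentation `ε`, the sequence
`⋯ → F₂ → F₁ → F₀ → N → 0` is exact. -/
def IsResolutionOf (F : MultigradedFreeComplex σ k) {N : Type*} [AddCommGroup N]
    [Module (MvPolynomial σ k) N] [Module k N] (𝒩 : (σ →₀ ℕ) → Submodule k N) : Prop :=
  ∃ ε : (F.ι 0 →₀ MvPolynomial σ k) →ₗ[MvPolynomial σ k] N,
    (∀ b, ε (Finsupp.single b 1) ∈ 𝒩 (F.mdeg 0 b)) ∧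
    Function.Surjective ε ∧ Function.Exact (F.d 0) ε ∧
    ∀ i, Function.Exact (F.d (i + 1)) (F.d i)

/-- `F` is minimal: the image of each differential is contained in `𝔪 Fᵢ`, where `𝔪` is the ideal
generated by the variables. -/
def IsMinimal (F : MultigradedFreeComplex σ k) : Prop :=
  ∀ i, LinearMap.range (F.d i) ≤
    Ideal.span (Set.range (MvPolynomial.X : σ → MvPolynomial σ k)) •
      (⊤ : Submodule (MvPolynomial σ k) (F.ι i →₀ MvPolynomial σ k))

end MultigradedFreeComplex

/-- The multigraded components of `S ⧸ M`: the images of the lines spanned by the monomials. -/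
noncomputable def quotientComponent {σ k : Type*} [Field k] (M : Ideal (MvPolynomial σ k))
    (a : σ →₀ ℕ) : Submodule k (MvPolynomial σ k ⧸ M) :=
  (LinearMap.range (MvPolynomial.monomial (R := k) a)).map (Ideal.Quotient.mkₐ k M).toLinearMap

/-- The multigraded components of `M`, viewed as an `S`-module: the elements of `M` that are scalar
multiples of a given monomial. -/
noncomputable def idealComponent {σ k : Type*} [Field k] (M : Ideal (MvPolynomial σ k))
    (a : σ →₀ ℕ) : Submodule k M :=
  (LinearMap.range (MvPolynomial.monomial (R := k) a)).comap (M.subtype.restrictScalars k)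

section Taylor

variable {σ : Type*} (k : Type*) [Field k] {q : ℕ} (g : Fin q → σ →₀ ℕ)

/-- The coefficient of `e_{s \ {j}}` in the Taylor differential of `e_s`:
`± lcm (g i | i ∈ s) / lcm (g i | i ∈ s \ {j})`, with sign `(-1) ^ #{l ∈ s | l < j}`. -/
noncomputable def taylorCoeff (s : Finset (Fin q)) (j : Fin q) : MvPolynomial σ k :=
  MvPolynomial.monomial (s.sup g - (s.erase j).sup g) ((-1) ^ (s.filter (· < j)).card)

/-- The Taylor differential `e_s ↦ ∑_{j ∈ s} ± (lcm s / lcm (s \ {j})) e_{s \ {j}}`, where the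
basis in homological degree `i` consists of the symbols `e_s`, `s` an `i`-element set of indices. -/
noncomputable def taylorD (i : ℕ) :
    ({s : Finset (Fin q) // s.card = i + 1} →₀ MvPolynomial σ k) →ₗ[MvPolynomial σ k]
      ({s : Finset (Fin q) // s.card = i} →₀ MvPolynomial σ k) :=
  Finsupp.linearCombination (MvPolynomial σ k) fun s =>
    ∑ j : {j // j ∈ s.1}, Finsupp.single
      ⟨s.1.erase j.1, by rw [Finset.card_erase_of_mem j.2, s.2]; rfl⟩ (taylorCoeff k g s.1 j.1)

theorem taylorCoeff_mul_erase (s : Finset (Fin q)) (j l : Fin q) :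
    taylorCoeff k g s j * taylorCoeff k g (s.erase j) l =
      MvPolynomial.monomial (s.sup g - ((s.erase j).erase l).sup g)
        ((-1) ^ ((s.filter (· < j)).card + ((s.erase j).filter (· < l)).card)) := by
  rw [taylorCoeff, taylorCoeff, MvPolynomial.monomial_mul, pow_add,
    tsub_add_tsub_cancel (Finset.sup_mono (Finset.erase_subset _ _))
      (Finset.sup_mono (Finset.erase_subset _ _))]

theorem taylorCoeff_anticomm (s : Finset (Fin q)) {j l : Fin q} (hj : j ∈ s) (hl : l ∈ s)
    (hjl : j ≠ l) :
    taylorCoeff k g s j * taylorCoeff k g (s.erase j) l +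
      taylorCoeff k g s l * taylorCoeff k g (s.erase l) j = 0 := by
  wlog h : j < l generalizing j l
  · rw [add_comm]
    exact this hl hj hjl.symm (lt_of_le_of_ne (not_lt.mp h) hjl.symm)
  have h1 : ((s.erase j).filter (· < l)).card + 1 = (s.filter (· < l)).card := by
    rw [Finset.filter_erase, Finset.card_erase_add_one]
    simp [hj, h]
  have h2 : (s.erase l).filter (· < j) = s.filter (· < j) := by
    rw [Finset.filter_erase, Finset.erase_eq_of_notMem]
    simp [h.le]
  rw [taylorCoeff_mul_erase, taylorCoeff_mul_erase, h2, ← h1, Finset.erase_right_comm, ← map_add]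
  have h3 : ∀ a b : ℕ, (-1 : k) ^ (a + b) + (-1) ^ (b + 1 + a) = 0 := fun a b => by ring
  rw [h3, map_zero]

theorem taylorD_comp (i : ℕ) : taylorD k g i ∘ₗ taylorD k g (i + 1) = 0 := by
  refine Finsupp.lhom_ext' fun s => LinearMap.ext_ring ?_
  simp only [taylorD, LinearMap.comp_apply, Finsupp.lsingle_apply,
    Finsupp.linearCombination_single, one_smul, map_sum, LinearMap.zero_apply, Finset.smul_sum,
    Finsupp.smul_single, smul_eq_mul]
  rw [Finset.sum_sigma']
  refine Finset.sum_involution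
    (fun p _ => ⟨⟨p.2.1, Finset.mem_of_mem_erase p.2.2⟩,
      ⟨p.1.1, Finset.mem_erase.mpr ⟨(Finset.ne_of_mem_erase p.2.2).symm, p.1.2⟩⟩⟩) ?_ ?_ ?_ ?_
  · rintro ⟨⟨j, hj⟩, ⟨l, hl⟩⟩ -
    have hl' := Finset.mem_erase.mp hl
    have := taylorCoeff_anticomm k g s.1 hj hl'.2 hl'.1.symm
    simp only [Finset.erase_right_comm (a := l) (b := j)]
    rw [← Finsupp.single_add, this, Finsupp.single_zero]
  · rintro ⟨⟨j, hj⟩, ⟨l, hl⟩⟩ - - h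
    exact (Finset.mem_erase.mp hl).1 (congrArg (fun p => p.1.1) h)
  · intros; exact Finset.mem_univ _
  · intros; rfl

/-- The Taylor resolution (of `S ⧸ M`, where `M` is generated by the monomials `g j`): its basis in
homological degree `i` is the set of all `i`-element sets `s` of indices, and the multidegree of the
basis element `s` is `lcm (g j | j ∈ s)`. -/
noncomputable def taylorResolution : MultigradedFreeComplex σ k where
  ι i := {s : Finset (Fin q) // s.card = i}
  finite _ := inferInstance
  mdeg _ s := s.1.sup g
  d := taylorD k g
  d_comp_d := taylorD_comp k g
  d_homogeneous := by
    classical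
    intro i b c e he
    rw [taylorD, Finsupp.linearCombination_single, one_smul, Finsupp.finsetSum_apply] at he
    obtain ⟨j, -, hj⟩ := Finset.mem_biUnion.mp (MvPolynomial.support_sum he)
    rw [Finsupp.single_apply] at hj
    split_ifs at hj with h
    · rw [← h]
      have := Finset.mem_singleton.mp (MvPolynomial.support_monomial_subset hj)
      rw [this]
      exact tsub_add_cancel_of_le (Finset.sup_mono (Finset.erase_subset _ _))
    · simp at hj

end Taylor

/-!
The signed number `∑ᵢ (-1)ⁱ #{b ∈ Fᵢ | mdeg b = m}` of basis elements of multidegree `m` in a minimal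
multigraded free resolution `F` is determined by the Hilbert function of the resolved module.
Indeed, exactness in multidegree `a` gives `∑ᵢ (-1)ⁱ #{b ∈ Fᵢ | mdeg b ≤ a} = dim N_a`
(`MultigradedFreeComplex.sum_neg_one_pow_card_mdeg_le`), and the sums over the `t ≤ a`, for all
`a ≤ m`, determine the summand at `m` (`eq_of_sum_Iic_eq`). Minimality makes the alternating sums
finite: a basis element in homological degree `i` has total degree at least `i`
(`MultigradedFreeComplex.le_degree_mdeg`).

By inclusion-exclusion the signed numbers `∑ (-1) ^ #s` of Taylor basis elements have the Hilbert
function of `S ⧸ M` as their sums over the `t ≤ a` (`sum_Iic_taylorEuler`); exactness of the Taylor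
complex is not needed for this. So the signed number for a minimal resolution of `S ⧸ M` is the one
for the Taylor resolution; for a resolution of `M` it changes sign, as `m ≠ 0`. This number has
the parity of the number of Taylor basis elements of multidegree `m`, so it is nonzero if the latter
is odd.

The Taylor basis elements of multidegree `m` correspond to the subsets of `A` that contain a minimal
generator of `m`. Modulo 2, inclusion-exclusion over the family of minimal generators leaves only
the subfamilies whose union is `A`, and for a dominant family that covers `A` the whole family is the
only one (`odd_card_filter_exists_subset`).
-/

/-! ### Modules with multigraded projections -/

/-- A multigrading of an `S`-module `N`, `S = k[σ]`, encoded by the `k`-linear projections `p a` of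
`N` onto its components: they are orthogonal idempotents, and multiplication by the monomial with
exponent vector `e` shifts degrees by `e`. The component of multidegree `a` is the range of `p a`.
Neither `∑ a, p a = 1` nor local finiteness of the sum is required. -/
structure IsMultigradedProjection {σ k N : Type*} [Field k] [AddCommGroup N]
    [Module (MvPolynomial σ k) N] [Module k N] (p : (σ →₀ ℕ) → N →ₗ[k] N) : Prop where
  apply_self : ∀ a x, p a (p a x) = p a x
  apply_of_ne : ∀ a b x, a ≠ b → p a (p b x) = 0
  add_smul : ∀ e a x, p (e + a) (MvPolynomial.monomial e (1 : k) • x) =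
    MvPolynomial.monomial e (1 : k) • p a x
  smul_of_not_le : ∀ e a x, ¬ e ≤ a → p a (MvPolynomial.monomial e (1 : k) • x) = 0

theorem IsMultigradedProjection.monomial_smul {σ k N : Type*} [Field k] [AddCommGroup N]
    [Module (MvPolynomial σ k) N] [Module k N] {p : (σ →₀ ℕ) → N →ₗ[k] N}
    (hp : IsMultigradedProjection p) {t : σ →₀ ℕ} {x : N} (hx : p t x = x) (e a : σ →₀ ℕ)
    [Decidable (e + t = a)] :
    p a (MvPolynomial.monomial e (1 : k) • x) =
      if e + t = a then MvPolynomial.monomial e (1 : k) • x else 0 := by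
  split_ifs with h
  · rw [← h, hp.add_smul, hx]
  · by_cases hea : e ≤ a
    · obtain ⟨b, rfl⟩ := exists_add_of_le hea
      rw [hp.add_smul, ← hx, hp.apply_of_ne _ _ _ fun hbt => h (by rw [hbt]), smul_zero]
    · exact hp.smul_of_not_le _ _ _ hea

section FreeModule

variable {σ k ι : Type*} [Field k]

/-- The `k`-basis of the free `S`-module on `ι` that consists of the products of a monomial and
a basis element. -/
noncomputable def freeMonomialBasis (σ k ι : Type*) [Field k] :
    Module.Basis (Σ _ : ι, σ →₀ ℕ) k (ι →₀ MvPolynomial σ k) :=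
  Finsupp.basis fun _ => MvPolynomial.basisMonomials σ k

theorem freeMonomialBasis_apply (x : Σ _ : ι, σ →₀ ℕ) :
    freeMonomialBasis σ k ι x = Finsupp.single x.1 (MvPolynomial.monomial x.2 1) := by
  simp [freeMonomialBasis]

theorem freeMonomialBasis_eq_smul (x : Σ _ : ι, σ →₀ ℕ) :
    freeMonomialBasis σ k ι x =
      MvPolynomial.monomial x.2 (1 : k) • Finsupp.single x.1 (1 : MvPolynomial σ k) := by
  simp [freeMonomialBasis_apply]

@[elab_as_elim]
theorem freeMonomialBasis_induction {P : (ι →₀ MvPolynomial σ k) → Prop}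
    (x : ι →₀ MvPolynomial σ k) (zero : P 0) (add : ∀ x y, P x → P y → P (x + y))
    (smul : ∀ (c : k) x, P x → P (c • x)) (basis : ∀ x, P (freeMonomialBasis σ k ι x)) : P x := by
  induction (freeMonomialBasis σ k ι).mem_span x using Submodule.span_induction with
  | mem x hx =>
    obtain ⟨y, rfl⟩ := hx
    exact basis y
  | zero => exact zero
  | add x y _ _ hx hy => exact add x y hx hy
  | smul c x _ hx => exact smul c x hx

open Classical in
/-- The projection of the free `S`-module on `ι`, where `b : ι` has multidegree `mdeg b`, onto its
component of multidegree `a`. -/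
noncomputable def freeProjection (k : Type*) [Field k] (mdeg : ι → σ →₀ ℕ) (a : σ →₀ ℕ) :
    (ι →₀ MvPolynomial σ k) →ₗ[k] (ι →₀ MvPolynomial σ k) :=
  (freeMonomialBasis σ k ι).constr k fun x =>
    if x.2 + mdeg x.1 = a then freeMonomialBasis σ k ι x else 0

open Classical in
theorem freeProjection_freeMonomialBasis (mdeg : ι → σ →₀ ℕ) (a : σ →₀ ℕ) (x : Σ _ : ι, σ →₀ ℕ) :
    freeProjection k mdeg a (freeMonomialBasis σ k ι x) =
      if x.2 + mdeg x.1 = a then freeMonomialBasis σ k ι x else 0 := by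
  simp [freeProjection]

theorem monomial_smul_freeMonomialBasis (e : σ →₀ ℕ) (x : Σ _ : ι, σ →₀ ℕ) :
    MvPolynomial.monomial e (1 : k) • freeMonomialBasis σ k ι x =
      freeMonomialBasis σ k ι ⟨x.1, e + x.2⟩ := by
  simp [freeMonomialBasis_apply, MvPolynomial.monomial_mul]

theorem isMultigradedProjection_freeProjection (mdeg : ι → σ →₀ ℕ) :
    IsMultigradedProjection (freeProjection k mdeg) where
  apply_self a x := by
    refine LinearMap.congr_fun (f := freeProjection k mdeg a ∘ₗ freeProjection k mdeg a) ?_ x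
    refine (freeMonomialBasis σ k ι).ext fun x => ?_
    rw [LinearMap.comp_apply, freeProjection_freeMonomialBasis]
    split_ifs with h
    · rw [freeProjection_freeMonomialBasis, if_pos h]
    · rw [map_zero]
  apply_of_ne a b x hab := by
    refine LinearMap.congr_fun (f := freeProjection k mdeg a ∘ₗ freeProjection k mdeg b)
      (g := 0) ?_ x
    refine (freeMonomialBasis σ k ι).ext fun x => ?_
    rw [LinearMap.comp_apply, freeProjection_freeMonomialBasis]
    split_ifs with h
    · rw [freeProjection_freeMonomialBasis, if_neg fun h' => hab (h'.symm.trans h),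
        LinearMap.zero_apply]
    · rw [map_zero, LinearMap.zero_apply]
  add_smul e a x := by
    induction x using freeMonomialBasis_induction with
    | zero => simp only [smul_zero, map_zero]
    | add x y hx hy => simp only [smul_add, map_add, hx, hy]
    | smul c x hx => rw [smul_comm, map_smul, hx, map_smul, smul_comm]
    | basis x =>
      rw [monomial_smul_freeMonomialBasis, freeProjection_freeMonomialBasis,
        freeProjection_freeMonomialBasis]
      by_cases h : x.2 + mdeg x.1 = a
      · rw [if_pos h, if_pos (by rw [add_assoc, h]), monomial_smul_freeMonomialBasis]
      · rw [if_neg h, if_neg (by rwa [add_assoc, add_right_inj]), smul_zero]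
  smul_of_not_le e a x hea := by
    induction x using freeMonomialBasis_induction with
    | zero => simp only [smul_zero, map_zero]
    | add x y hx hy => simp only [smul_add, map_add, hx, hy, add_zero]
    | smul c x hx => rw [smul_comm, map_smul, hx, smul_zero]
    | basis x =>
      rw [monomial_smul_freeMonomialBasis, freeProjection_freeMonomialBasis, if_neg]
      rintro rfl
      exact hea (by rw [add_assoc]; exact le_self_add)

/-- A homogeneous map out of a free module commutes with the projections. -/
theorem IsMultigradedProjection.apply_map {N : Type*} [AddCommGroup N]
    [Module (MvPolynomial σ k) N] [Module k N] [IsScalarTower k (MvPolynomial σ k) N]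
    {p : (σ →₀ ℕ) → N →ₗ[k] N} (hp : IsMultigradedProjection p) {mdeg : ι → σ →₀ ℕ}
    (φ : (ι →₀ MvPolynomial σ k) →ₗ[MvPolynomial σ k] N)
    (hφ : ∀ b, p (mdeg b) (φ (Finsupp.single b 1)) = φ (Finsupp.single b 1)) (a : σ →₀ ℕ)
    (x : ι →₀ MvPolynomial σ k) : p a (φ x) = φ (freeProjection k mdeg a x) := by
  classical
  refine LinearMap.congr_fun (f := p a ∘ₗ φ.restrictScalars k)
      (g := φ.restrictScalars k ∘ₗ freeProjection k mdeg a) ?_ x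
  refine (freeMonomialBasis σ k ι).ext fun x => ?_
  simp only [LinearMap.comp_apply, LinearMap.restrictScalars_apply,
    freeProjection_freeMonomialBasis]
  rw [freeMonomialBasis_eq_smul, map_smul, hp.monomial_smul (hφ _), ← map_smul]
  split_ifs <;> simp

theorem range_freeProjection (mdeg : ι → σ →₀ ℕ) (a : σ →₀ ℕ) :
    LinearMap.range (freeProjection k mdeg a) = Submodule.span k (Set.range
      fun b : {b // mdeg b ≤ a} => freeMonomialBasis σ k ι ⟨b.1, a - mdeg b.1⟩) := by
  classical
  rw [freeProjection, Module.Basis.constr_range]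
  apply le_antisymm <;> rw [Submodule.span_le]
  · rintro _ ⟨⟨b, e⟩, rfl⟩
    dsimp only
    split_ifs with h
    · have hb : mdeg b ≤ a := h ▸ le_add_self
      refine Submodule.subset_span ⟨⟨b, hb⟩, ?_⟩
      simp only [← h, add_tsub_cancel_right]
    · exact zero_mem _
  · rintro _ ⟨⟨b, hb⟩, rfl⟩
    exact Submodule.subset_span ⟨⟨b, a - mdeg b⟩, if_pos (tsub_add_cancel_of_le hb)⟩

theorem finite_range_freeProjection [Finite ι] (mdeg : ι → σ →₀ ℕ) (a : σ →₀ ℕ) :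
    Module.Finite k (LinearMap.range (freeProjection k mdeg a)) := by
  rw [range_freeProjection]
  exact FiniteDimensional.span_of_finite k (Set.finite_range _)

theorem finrank_range_freeProjection [Finite ι] (mdeg : ι → σ →₀ ℕ) (a : σ →₀ ℕ) :
    Module.finrank k (LinearMap.range (freeProjection k mdeg a)) =
      Nat.card {b // mdeg b ≤ a} := by
  have := Fintype.ofFinite {b // mdeg b ≤ a}
  rw [range_freeProjection, Nat.card_eq_fintype_card]
  refine finrank_span_eq_card ((freeMonomialBasis σ k ι).linearIndependent.comp
    (fun b : {b // mdeg b ≤ a} => ⟨b.1, a - mdeg b.1⟩) fun b c h => ?_)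
  exact Subtype.ext (congrArg Sigma.fst h)

/-- An element is fixed by the projection to degree `a` if all its terms have multidegree `a`. -/
theorem freeProjection_eq_self (mdeg : ι → σ →₀ ℕ) (a : σ →₀ ℕ) (x : ι →₀ MvPolynomial σ k)
    (hx : ∀ c, ∀ e ∈ (x c).support, e + mdeg c = a) : freeProjection k mdeg a x = x := by
  classical
  have key : ∀ c, freeProjection k mdeg a (Finsupp.single c (x c)) = Finsupp.single c (x c) := by
    intro c
    have h1 : Finsupp.single c (x c) = ∑ e ∈ (x c).support,
        (x c).coeff e • freeMonomialBasis σ k ι ⟨c, e⟩ := by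
      conv_lhs => rw [(x c).as_sum, Finsupp.single_finsetSum]
      refine Finset.sum_congr rfl fun e _ => ?_
      rw [freeMonomialBasis_apply, Finsupp.smul_single, MvPolynomial.smul_monomial, smul_eq_mul,
        mul_one]
    rw [h1, map_sum]
    refine Finset.sum_congr rfl fun e he => ?_
    rw [map_smul, freeProjection_freeMonomialBasis, if_pos (hx c e he)]
  conv_lhs => rw [← x.sum_single, Finsupp.sum, map_sum]
  conv_rhs => rw [← x.sum_single, Finsupp.sum]
  exact Finset.sum_congr rfl fun c _ => key c

end FreeModule

/-! ### Euler characteristics of multigraded strands -/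

/-- Rank-nullity for the strand of an exact sequence that is cut out by projections. -/
theorem finrank_range_eq_of_exact {k U V W : Type*} [Field k] [AddCommGroup U] [AddCommGroup V]
    [AddCommGroup W] [Module k U] [Module k V] [Module k W] {f : U →ₗ[k] V} {g : V →ₗ[k] W}
    (hfg : Function.Exact f g) {u : U →ₗ[k] U} {v : V →ₗ[k] V} (huv : ∀ x, v (f x) = f (u x))
    (hv : ∀ x, v (v x) = v x) [Module.Finite k (LinearMap.range v)] :
    Module.finrank k (LinearMap.range v) =
      Module.finrank k (LinearMap.range (f ∘ₗ u)) + Module.finrank k (LinearMap.range (g ∘ₗ v)) := by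
  rw [← LinearMap.finrank_range_add_finrank_ker (g.domRestrict (LinearMap.range v)), add_comm]
  have h1 : LinearMap.range (g.domRestrict (LinearMap.range v)) = LinearMap.range (g ∘ₗ v) := by
    rw [LinearMap.range_domRestrict, LinearMap.range_comp]
  have h2 : (LinearMap.ker (g.domRestrict (LinearMap.range v))).map (LinearMap.range v).subtype =
      LinearMap.range (f ∘ₗ u) := by
    ext x
    constructor
    · rintro ⟨⟨_, y, rfl⟩, hy, rfl⟩
      obtain ⟨z, hz⟩ := (hfg (v y)).mp hy
      exact ⟨z, by simp [← huv, hz, hv]⟩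
    · rintro ⟨z, rfl⟩
      exact ⟨⟨_, f z, huv z⟩, (hfg _).mpr ⟨u z, rfl⟩, rfl⟩
  rw [h1, ← h2, LinearEquiv.finrank_eq (Submodule.equivSubtypeMap _ _)]

theorem sum_range_neg_one_pow_of_eq_add {v r : ℕ → ℕ} {h : ℕ} (h0 : v 0 = r 0 + h)
    (hs : ∀ i, v (i + 1) = r (i + 1) + r i) (n : ℕ) :
    ∑ i ∈ Finset.range (n + 1), (-1 : ℤ) ^ i * v i = h + (-1) ^ n * r n := by
  induction n with
  | zero => simp [h0, add_comm]
  | succ n ih => rw [Finset.sum_range_succ, ih, hs]; push_cast; ring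

namespace MultigradedFreeComplex

variable {σ k : Type*} [Field k] {F : MultigradedFreeComplex σ k}

theorem freeProjection_d (i : ℕ) (b : F.ι (i + 1)) :
    freeProjection k (F.mdeg i) (F.mdeg (i + 1) b) (F.d i (Finsupp.single b 1)) =
      F.d i (Finsupp.single b 1) :=
  freeProjection_eq_self _ _ _ fun c e he => F.d_homogeneous i b c e he

theorem constantCoeff_d (hF : F.IsMinimal) (i : ℕ) (x : F.ι (i + 1) →₀ MvPolynomial σ k)
    (c : F.ι i) : MvPolynomial.constantCoeff (F.d i x c) = 0 := by
  refine Submodule.smul_induction_on (hF i ⟨x, rfl⟩) (fun r hr n _ => ?_) fun y z hy hz => ?_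
  · have : r ∈ RingHom.ker (MvPolynomial.constantCoeff (R := k) (σ := σ)) := by
      refine (Ideal.span_le.mpr ?_) hr
      rintro _ ⟨j, rfl⟩
      simp [RingHom.mem_ker]
    rw [Finsupp.smul_apply, smul_eq_mul, map_mul, RingHom.mem_ker.mp this, zero_mul]
  · rw [Finsupp.add_apply, map_add, hy, hz, add_zero]

/-- In a minimal resolution the total degree of a basis element is at least its homological degree:
the differential of a basis element is nonzero, and all its coefficients have positive degree. -/
theorem le_degree_mdeg (hF : F.IsMinimal) (hex : ∀ i, Function.Exact (F.d (i + 1)) (F.d i)) :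
    ∀ i (b : F.ι i), i ≤ (F.mdeg i b).degree
  | 0, _ => Nat.zero_le _
  | i + 1, b => by
    have hd : F.d i (Finsupp.single b 1) ≠ 0 := by
      intro h
      obtain ⟨y, hy⟩ := (hex i _).mp h
      have := constantCoeff_d hF (i + 1) y b
      simp [hy] at this
    obtain ⟨c, hc⟩ := Finsupp.ne_iff.mp hd
    obtain ⟨e, he⟩ := MvPolynomial.ne_zero_iff.mp hc
    have he0 : e ≠ 0 := by
      rintro rfl
      exact he (constantCoeff_d hF i _ c)
    have hdeg := F.d_homogeneous i b c e (MvPolynomial.mem_support_iff.mpr he)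
    rw [← hdeg, map_add, add_comm]
    exact Nat.add_le_add
      (Nat.one_le_iff_ne_zero.mpr fun h => he0 ((Finsupp.degree_eq_zero_iff e).mp h))
      (le_degree_mdeg hF hex i c)

/-- The Hilbert function of the resolved module in multidegree `a` is the alternating sum of the
Hilbert functions of the free modules in a minimal resolution. -/
theorem sum_neg_one_pow_card_mdeg_le {N : Type*} [AddCommGroup N] [Module (MvPolynomial σ k) N]
    [Module k N] [IsScalarTower k (MvPolynomial σ k) N] {p : (σ →₀ ℕ) → N →ₗ[k] N}
    (hp : IsMultigradedProjection p) (hF : F.IsMinimal)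
    (hres : F.IsResolutionOf fun a => LinearMap.range (p a)) (a : σ →₀ ℕ) {n : ℕ}
    (hn : a.degree ≤ n) :
    ∑ i ∈ Finset.range (n + 1), (-1 : ℤ) ^ i * Nat.card {b : F.ι i // F.mdeg i b ≤ a} =
      Module.finrank k (LinearMap.range (p a)) := by
  obtain ⟨ε, hε, hsurj, hex0, hex⟩ := hres
  have := F.finite
  have hfin := fun i => finite_range_freeProjection (k := k) (F.mdeg i) a
  have hd := fun i x => (isMultigradedProjection_freeProjection (F.mdeg i)).apply_map
    (F.d i) (freeProjection_d i) a x
  have hεp : ∀ x, p a (ε x) = ε (freeProjection k (F.mdeg 0) a x) := by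
    refine hp.apply_map ε (fun b => ?_) a
    obtain ⟨y, hy⟩ := hε b
    rw [← hy, hp.apply_self]
  have hself := fun i => (isMultigradedProjection_freeProjection (k := k) (F.mdeg i)).apply_self a
  -- The ranks of the differentials on the strand of multidegree `a`.
  let r : ℕ → ℕ := fun i => Module.finrank k
    (LinearMap.range ((F.d i).restrictScalars k ∘ₗ freeProjection k (F.mdeg (i + 1)) a))
  have h0 : Nat.card {b : F.ι 0 // F.mdeg 0 b ≤ a} =
      r 0 + Module.finrank k (LinearMap.range (p a)) := by
    have h1 : ε.restrictScalars k ∘ₗ freeProjection k (F.mdeg 0) a = p a ∘ₗ ε.restrictScalars k :=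
      LinearMap.ext fun x => (hεp x).symm
    rw [← finrank_range_freeProjection (k := k), finrank_range_eq_of_exact
      (f := (F.d 0).restrictScalars k) (g := ε.restrictScalars k) hex0 (hd 0) (hself 0), h1,
      LinearMap.range_comp_of_range_eq_top (f := ε.restrictScalars k) _
        (LinearMap.range_eq_top.mpr hsurj)]
  have hs : ∀ i, Nat.card {b : F.ι (i + 1) // F.mdeg (i + 1) b ≤ a} = r (i + 1) + r i := by
    intro i
    rw [← finrank_range_freeProjection (k := k), finrank_range_eq_of_exact
      (f := (F.d (i + 1)).restrictScalars k) (g := (F.d i).restrictScalars k) (hex i)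
      (hd (i + 1)) (hself (i + 1))]
  -- The strand of multidegree `a` vanishes in homological degrees above `a.degree`.
  have hrn : r n = 0 := by
    have hempty : IsEmpty {b : F.ι (n + 1) // F.mdeg (n + 1) b ≤ a} :=
      ⟨fun b => absurd ((le_degree_mdeg hF hex (n + 1) b.1).trans
        ((Finsupp.degree_mono b.2).trans hn)) (Nat.not_succ_le_self n)⟩
    have := hs n
    rw [Nat.card_of_isEmpty] at this
    omega
  rw [sum_range_neg_one_pow_of_eq_add h0 hs, hrn]
  simp

end MultigradedFreeComplex

/-- Fibrewise count of the indices whose degree is bounded by `a`. -/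
theorem natCard_le_eq_sum {σ ι : Type*} [Finite ι] (f : ι → σ →₀ ℕ) (a : σ →₀ ℕ) [DecidableEq σ] :
    Nat.card {b // f b ≤ a} = ∑ t ∈ Finset.Iic a, Nat.card {b // f b = t} := by
  classical
  have := Fintype.ofFinite ι
  simp only [Nat.card_eq_fintype_card, Fintype.card_subtype]
  rw [Finset.card_eq_sum_card_fiberwise (f := f) (t := Finset.Iic a)]
  · refine Finset.sum_congr rfl fun t ht => congrArg Finset.card ?_
    ext b
    simp only [Finset.mem_filter, Finset.mem_univ, true_and]
    exact ⟨And.right, fun h => ⟨h ▸ Finset.mem_Iic.mp ht, h⟩⟩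
  · intro b hb
    simpa using hb

theorem eq_of_sum_Iic_eq {α G : Type*} [PartialOrder α] [LocallyFiniteOrderBot α]
    [WellFoundedLT α] [AddCommGroup G] {f g : α → G} {m : α}
    (h : ∀ a ≤ m, ∑ t ∈ Finset.Iic a, f t = ∑ t ∈ Finset.Iic a, g t) : ∀ a ≤ m, f a = g a := by
  classical
  intro a
  induction a using WellFoundedLT.induction with
  | ind a ih =>
    intro ha
    have := h a ha
    rw [← Finset.Iio_insert, Finset.sum_insert (by simp), Finset.sum_insert (by simp),
      Finset.sum_congr rfl fun t ht => ih t (Finset.mem_Iio.mp ht)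
        ((Finset.mem_Iio.mp ht).le.trans ha)] at this
    exact add_right_cancel this

/-- If the Hilbert function of the resolved module is the sum function of `u`, then the signed
number of basis elements of multidegree `m` in a minimal resolution is `u m`; so there is a basis
element of multidegree `m` as soon as `u m ≠ 0`. -/
theorem MultigradedFreeComplex.basisOfMultidegree_nonempty {σ k N : Type*} [Field k]
    [DecidableEq σ] [AddCommGroup N] [Module (MvPolynomial σ k) N] [Module k N]
    [IsScalarTower k (MvPolynomial σ k) N] {p : (σ →₀ ℕ) → N →ₗ[k] N}
    (hp : IsMultigradedProjection p) {F : MultigradedFreeComplex σ k} (hF : F.IsMinimal)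
    (hres : F.IsResolutionOf fun a => LinearMap.range (p a)) {u : (σ →₀ ℕ) → ℤ}
    (hu : ∀ a, ∑ t ∈ Finset.Iic a, u t = Module.finrank k (LinearMap.range (p a)))
    {m : σ →₀ ℕ} (hm : u m ≠ 0) : (F.basisOfMultidegree m).Nonempty := by
  have := F.finite
  let c : (σ →₀ ℕ) → ℤ := fun t =>
    ∑ i ∈ Finset.range (m.degree + 1), (-1 : ℤ) ^ i * Nat.card {b : F.ι i // F.mdeg i b = t}
  have hc : c m = u m := by
    refine eq_of_sum_Iic_eq (fun a ha => ?_) m le_rfl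
    rw [hu, ← sum_neg_one_pow_card_mdeg_le hp hF hres a (Finsupp.degree_mono ha),
      Finset.sum_comm]
    refine Finset.sum_congr rfl fun i _ => ?_
    rw [natCard_le_eq_sum, Nat.cast_sum, Finset.mul_sum]
  rw [Set.nonempty_iff_ne_empty]
  intro hempty
  refine hm (hc ▸ Finset.sum_eq_zero fun i _ => ?_)
  have : IsEmpty {b : F.ι i // F.mdeg i b = m} :=
    ⟨fun b => (hempty ▸ (show (⟨i, b.1⟩ : Σ i, F.ι i) ∈ F.basisOfMultidegree m from b.2) :
      (⟨i, b.1⟩ : Σ i, F.ι i) ∈ (∅ : Set _))⟩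
  simp

/-! ### Counting supersets of a dominant family -/

/-- Expanding `∏ C ∈ 𝓕, (1 - [C ⊆ B])` and summing over `B ⊆ A`, the subfamily `T` contributes
`2 ^ #(A \ ⋃ T)`, which is odd for `T = 𝓕` only. So the number of subsets of `A` that contain no
member of `𝓕` is odd, and so is the number of the others, as `2 ^ #A` is even. -/
theorem odd_card_filter_exists_subset {α : Type*} [DecidableEq α] {A : Finset α}
    {𝓕 : Finset (Finset α)} (hA : A.Nonempty) (hcover : 𝓕.sup id = A)
    (hdom : ∀ T ⊆ 𝓕, T.sup id = A → T = 𝓕) :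
    Odd (A.powerset.filter fun B => ∃ C ∈ 𝓕, C ⊆ B).card := by
  have htotal : (A.powerset.card : ZMod 2) = 0 := by
    rw [Finset.card_powerset, Nat.cast_pow, show ((2 : ℕ) : ZMod 2) = 0 from rfl,
      zero_pow (Finset.card_pos.mpr hA).ne']
  -- Coefficients are taken in `ZMod 2`, where `1 - x = 1 + x`.
  have hnot : ((A.powerset.filter fun B => ¬ ∃ C ∈ 𝓕, C ⊆ B).card : ZMod 2) = 1 := by
    have h1 : ∀ B : Finset α, (if ¬ ∃ C ∈ 𝓕, C ⊆ B then (1 : ZMod 2) else 0) =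
        ∑ T ∈ 𝓕.powerset, if T.sup id ⊆ B then 1 else 0 := by
      intro B
      have h2 : ∀ C : Finset α, (if C ⊆ B then (0 : ZMod 2) else 1) =
          1 + if C ⊆ B then 1 else 0 := by
        intro C; split_ifs <;> rfl
      have h3 : (if ¬ ∃ C ∈ 𝓕, C ⊆ B then (1 : ZMod 2) else 0) =
          ∏ C ∈ 𝓕, if C ⊆ B then (0 : ZMod 2) else 1 := by
        by_cases h : ∃ C ∈ 𝓕, C ⊆ B
        · obtain ⟨C, hC, hCB⟩ := h
          exact (if_neg (not_not.mpr ⟨C, hC, hCB⟩)).trans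
            (Finset.prod_eq_zero hC (by exact if_pos hCB)).symm
        · rw [if_pos h, Finset.prod_eq_one]
          exact fun C hC => if_neg fun hCB => h ⟨C, hC, hCB⟩
      rw [h3, Finset.prod_congr rfl fun C _ => h2 C, Finset.prod_one_add]
      refine Finset.sum_congr rfl fun T _ => ?_
      rw [Finset.prod_boole]
      exact if_congr (Finset.sup_le_iff (f := id) (a := B)).symm rfl rfl
    rw [Finset.card_filter, Nat.cast_sum]
    simp only [Nat.cast_ite, Nat.cast_one, Nat.cast_zero]
    rw [Finset.sum_congr rfl fun B _ => h1 B, Finset.sum_comm,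
      Finset.sum_eq_single_of_mem 𝓕 (Finset.mem_powerset_self _)]
    · rw [hcover, Finset.sum_eq_single_of_mem A (Finset.mem_powerset_self _), if_pos subset_rfl]
      exact fun B hB hBA => if_neg fun h => hBA ((Finset.mem_powerset.mp hB).antisymm h)
    · intro T hT hTF
      have hT' := Finset.mem_powerset.mp hT
      have hTA : T.sup id ⊆ A := hcover ▸ Finset.sup_mono hT'
      have hlt : (T.sup id).card < A.card := Finset.card_lt_card
        (hTA.ssubset_of_ne fun h => hTF (hdom T hT' h))
      have h4 : A.powerset.filter (T.sup id ⊆ ·) = Finset.Icc (T.sup id) A := by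
        ext B; simp [and_comm]
      rw [Finset.sum_boole, h4, Finset.card_Icc_finset hTA, Nat.cast_pow,
        show ((2 : ℕ) : ZMod 2) = 0 from rfl, zero_pow (Nat.sub_pos_of_lt hlt).ne']
  rw [← ZMod.natCast_eq_one_iff_odd]
  have h5 := congrArg (Nat.cast (R := ZMod 2))
    (Finset.card_filter_add_card_filter_not (s := A.powerset) fun B => ∃ C ∈ 𝓕, C ⊆ B)
  rw [Nat.cast_add, hnot, htotal] at h5
  exact (eq_neg_of_add_eq_zero_left h5).trans (by decide)

/-- A set of monomials is a generator of `m` in a finite `A` with `lcm A ∣ m` if and only if it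
contains a minimal generator. -/
theorem isGeneratorOf_iff_exists_minimalGenerators {σ : Type*} {A : Set (σ →₀ ℕ)} {m : σ →₀ ℕ}
    (hAm : ∀ a ∈ A, a ≤ m) {B : Finset (σ →₀ ℕ)} (hB : (B : Set (σ →₀ ℕ)) ⊆ A) :
    IsGeneratorOf A m B ↔ ∃ C ∈ minimalGenerators A m, C ⊆ B := by
  constructor
  · induction B using Finset.strongInduction with
    | H B ih =>
      intro h
      by_cases hmin : ∀ C, C ⊂ B → ¬ IsGeneratorOf A m C
      · exact ⟨B, ⟨h, hmin⟩, subset_rfl⟩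
      · push Not at hmin
        obtain ⟨C, hCB, hC⟩ := hmin
        obtain ⟨D, hD, hDC⟩ := ih C hCB hC.1 hC
        exact ⟨D, hD, hDC.trans hCB.subset⟩
  · rintro ⟨C, hC, hCB⟩
    refine ⟨hB, le_antisymm (Finset.sup_le fun b hb => hAm b (hB hb)) ?_⟩
    rw [← hC.1.2]
    exact Finset.sup_mono hCB

theorem odd_card_filter_isGeneratorOf {σ : Type*} [DecidableEq (σ →₀ ℕ)] {m : σ →₀ ℕ}
    {A : Finset (σ →₀ ℕ)} (hAm : ∀ a ∈ A, a ≤ m)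
    (hunion : (A : Set (σ →₀ ℕ)) = ⋃ B ∈ minimalGenerators (A : Set (σ →₀ ℕ)) m,
      (B : Set (σ →₀ ℕ)))
    (hdom : IsDominantFamily (minimalGenerators (A : Set (σ →₀ ℕ)) m)) :
    Odd (A.powerset.filter fun B => B.sup id = m).card := by
  obtain ⟨hfin, ⟨B₀, hB₀⟩, hne, hnot⟩ := hdom
  have hcov : ∀ T : Finset (Finset (σ →₀ ℕ)),
      ((T.sup id : Finset (σ →₀ ℕ)) : Set (σ →₀ ℕ)) = ⋃ B ∈ T, (B : Set (σ →₀ ℕ)) := by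
    intro T; ext x; simp [Finset.mem_sup]
  have hodd := odd_card_filter_exists_subset (A := A) (𝓕 := hfin.toFinset) ?_ ?_ ?_
  · convert hodd using 2
    refine Finset.filter_congr fun B hB => ?_
    have hBA : (B : Set (σ →₀ ℕ)) ⊆ A := Finset.coe_subset.mpr (Finset.mem_powerset.mp hB)
    have := isGeneratorOf_iff_exists_minimalGenerators hAm hBA
    simp only [Set.Finite.mem_toFinset, ← this]
    exact ⟨fun h => ⟨hBA, h⟩, fun h => h.2⟩
  · exact (hne B₀ hB₀).mono (Finset.coe_subset.mp hB₀.1.1)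
  · rw [← Finset.coe_inj, hcov]
    refine Eq.trans ?_ hunion.symm
    simp
  · intro T hT hTA
    refine hT.antisymm fun C hC => ?_
    by_contra hCT
    rw [Set.Finite.mem_toFinset] at hC
    refine hnot C hC ?_
    have hAT := hcov T
    rw [hTA] at hAT
    refine hC.1.1.trans (hAT.le.trans ?_)
    refine Set.biUnion_subset_biUnion_left fun D hD => ⟨?_, ?_⟩
    · exact (Set.Finite.mem_toFinset hfin).mp (hT hD)
    · rintro rfl
      exact hCT hD

/-- The only minimal generator of the monomial `1` is `∅`, which no dominant family contains. -/
theorem ne_zero_of_isDominantFamily {σ : Type*} {A : Set (σ →₀ ℕ)} {m : σ →₀ ℕ}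
    (hdom : IsDominantFamily (minimalGenerators A m)) : m ≠ 0 := by
  rintro rfl
  obtain ⟨-, ⟨B, hB⟩, hne, -⟩ := hdom
  refine hB.2 ∅ (Finset.empty_ssubset.mpr (hne B hB)) ⟨by simp, ?_⟩
  rw [Finset.sup_empty, bot_eq_zero]

/-! ### Monomial ideals and their Taylor bases -/

theorem IsMinimallyGeneratedBy.injective {σ k : Type*} [Field k] {M : Ideal (MvPolynomial σ k)}
    {q : ℕ} {g : Fin q → σ →₀ ℕ} (hM : IsMinimallyGeneratedBy M g) : Function.Injective g := by
  intro i j hij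
  by_contra hne
  refine hM.2 i (Ideal.subset_span ⟨j, Ne.symm hne, ?_⟩)
  dsimp only
  rw [hij]

theorem IsMinimallyGeneratedBy.mem_iff {σ k : Type*} [Field k] {M : Ideal (MvPolynomial σ k)}
    {q : ℕ} {g : Fin q → σ →₀ ℕ} (hM : IsMinimallyGeneratedBy M g) {x : MvPolynomial σ k} :
    x ∈ M ↔ ∀ e ∈ x.support, ∃ j, g j ≤ e := by
  have : (Set.range fun j => MvPolynomial.monomial (g j) (1 : k)) =
      (fun s => MvPolynomial.monomial s (1 : k)) '' Set.range g := by
    rw [← Set.range_comp]; rfl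
  rw [hM.1, this, MvPolynomial.mem_ideal_span_monomial_image]
  simp

theorem IsMinimallyGeneratedBy.monomial_mem_iff {σ k : Type*} [Field k]
    {M : Ideal (MvPolynomial σ k)} {q : ℕ} {g : Fin q → σ →₀ ℕ} (hM : IsMinimallyGeneratedBy M g)
    {a : σ →₀ ℕ} {c : k} (hc : c ≠ 0) : MvPolynomial.monomial a c ∈ M ↔ ∃ j, g j ≤ a := by
  classical
  rw [hM.mem_iff, MvPolynomial.support_monomial, if_neg hc]
  simp

/-- The signed number of Taylor basis elements of multidegree `t`. -/
noncomputable def taylorEuler {σ : Type*} [DecidableEq (σ →₀ ℕ)] {q : ℕ} (g : Fin q → σ →₀ ℕ)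
    (t : σ →₀ ℕ) : ℤ :=
  ∑ s : Finset (Fin q) with s.sup g = t, (-1) ^ s.card

theorem sum_Iic_taylorEuler {σ : Type*} [DecidableEq σ] {q : ℕ} (g : Fin q → σ →₀ ℕ)
    (a : σ →₀ ℕ) [Decidable (∃ j, g j ≤ a)] :
    ∑ t ∈ Finset.Iic a, taylorEuler g t = if ∃ j, g j ≤ a then 0 else 1 := by
  classical
  have h1 : ∑ t ∈ Finset.Iic a, taylorEuler g t =
      ∑ s ∈ (Finset.univ.filter fun j => g j ≤ a).powerset, (-1) ^ s.card := by
    rw [← Finset.sum_fiberwise_of_maps_to (t := Finset.Iic a)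
      (g := fun s : Finset (Fin q) => s.sup g)]
    · refine Finset.sum_congr rfl fun t ht => Finset.sum_congr ?_ fun _ _ => rfl
      ext s
      simp only [Finset.mem_filter, Finset.mem_univ, true_and, Finset.mem_powerset]
      refine ⟨fun h => ⟨fun j hj => ?_, h⟩, And.right⟩
      rw [Finset.mem_filter]
      exact ⟨Finset.mem_univ _, (Finset.le_sup hj).trans (h.trans_le (Finset.mem_Iic.mp ht))⟩
    · intro s hs
      rw [Finset.mem_Iic]
      exact Finset.sup_le fun j hj =>
        (Finset.mem_filter.mp (Finset.mem_powerset.mp hs hj)).2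
  rw [h1, Finset.sum_powerset_neg_one_pow_card]
  by_cases h : ∃ j, g j ≤ a
  · rw [if_pos h, if_neg]
    obtain ⟨j, hj⟩ := h
    exact Finset.ne_empty_of_mem (Finset.mem_filter.mpr ⟨Finset.mem_univ j, hj⟩)
  · rw [if_neg h, if_pos]
    exact Finset.filter_eq_empty_iff.mpr fun j _ hj => h ⟨j, hj⟩

theorem ncard_basisOfMultidegree_taylorResolution {σ : Type*} (k : Type*) [Field k]
    [DecidableEq (σ →₀ ℕ)] {q : ℕ} (g : Fin q → σ →₀ ℕ) (m : σ →₀ ℕ) :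
    ((taylorResolution k g).basisOfMultidegree m).ncard =
      (Finset.univ.filter fun s : Finset (Fin q) => s.sup g = m).card := by
  rw [← Set.ncard_coe_finset]
  refine Set.ncard_congr (fun b _ => b.2.1) (fun b hb => ?_) ?_ fun s hs => ?_
  · exact Finset.mem_filter.mpr ⟨Finset.mem_univ _, hb⟩
  · rintro ⟨i, s, rfl⟩ ⟨j, t, rfl⟩ _ _ h
    obtain rfl : s = t := h
    rfl
  · exact ⟨⟨s.card, s, rfl⟩, (Finset.mem_filter.mp hs).2, rfl⟩

theorem taylorEuler_ne_zero {σ : Type*} [DecidableEq (σ →₀ ℕ)] {q : ℕ} {g : Fin q → σ →₀ ℕ}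
    {m : σ →₀ ℕ} (h : Odd (Finset.univ.filter fun s : Finset (Fin q) => s.sup g = m).card) :
    taylorEuler g m ≠ 0 := by
  intro h0
  have h1 := congrArg (Int.cast (R := ZMod 2)) h0
  rw [taylorEuler] at h1
  push_cast at h1
  rw [show (-1 : ZMod 2) = 1 by decide] at h1
  simp only [one_pow, Finset.sum_const, nsmul_eq_mul, mul_one] at h1
  rw [ZMod.natCast_eq_one_iff_odd.mpr h] at h1
  exact one_ne_zero h1

/-- For distinct monomials, the Taylor basis elements of multidegree `m` correspond to the
generators of `m` among the monomials that divide `m`. -/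
theorem card_filter_sup_eq {σ : Type*} [DecidableEq (σ →₀ ℕ)] {q : ℕ} {g : Fin q → σ →₀ ℕ}
    (hg : Function.Injective g) {m : σ →₀ ℕ} {A : Finset (σ →₀ ℕ)}
    (hA : (A : Set (σ →₀ ℕ)) = {a | a ∈ Set.range g ∧ a ≤ m}) :
    (Finset.univ.filter fun s : Finset (Fin q) => s.sup g = m).card =
      (A.powerset.filter fun B => B.sup id = m).card := by
  have hA' : ∀ a, a ∈ A ↔ a ∈ Set.range g ∧ a ≤ m := fun a => by
    rw [← Finset.mem_coe, hA]; rfl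
  refine Finset.card_bij (fun s _ => s.image g) (fun s hs => ?_)
    (fun s _ t _ h => Finset.image_injective hg h) fun B hB => ?_
  · rw [Finset.mem_filter] at hs
    rw [Finset.mem_filter, Finset.mem_powerset, Finset.sup_image]
    refine ⟨fun a ha => ?_, hs.2⟩
    obtain ⟨j, hj, rfl⟩ := Finset.mem_image.mp ha
    exact (hA' _).mpr ⟨⟨j, rfl⟩, hs.2 ▸ Finset.le_sup hj⟩
  · rw [Finset.mem_filter, Finset.mem_powerset] at hB
    have himage : (Finset.univ.filter fun j => g j ∈ B).image g = B := by
      ext a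
      simp only [Finset.mem_image, Finset.mem_filter, Finset.mem_univ, true_and]
      refine ⟨fun ⟨j, hj, h⟩ => h ▸ hj, fun ha => ?_⟩
      obtain ⟨j, rfl⟩ := ((hA' a).mp (hB.1 ha)).1
      exact ⟨j, ha, rfl⟩
    refine ⟨_, Finset.mem_filter.mpr ⟨Finset.mem_univ _, ?_⟩, himage⟩
    rw [← hB.2]
    conv_rhs => rw [← himage, Finset.sup_image]
    rfl

/-! ### The multigradings of `S`, `M` and `S ⧸ M` -/

section MonomialIdeal

variable {σ k : Type*} [Field k]

/-- The projection of the polynomial ring onto the line spanned by the monomial with exponent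
vector `a`. -/
noncomputable def monomialProjection (k : Type*) [Field k] (a : σ →₀ ℕ) :
    MvPolynomial σ k →ₗ[k] MvPolynomial σ k :=
  MvPolynomial.monomial a ∘ₗ MvPolynomial.lcoeff k a

theorem monomialProjection_apply (a : σ →₀ ℕ) (x : MvPolynomial σ k) :
    monomialProjection k a x = MvPolynomial.monomial a (x.coeff a) := rfl

theorem isMultigradedProjection_monomialProjection :
    IsMultigradedProjection (monomialProjection (σ := σ) k) where
  apply_self a x := by
    classical
    simp [monomialProjection_apply, MvPolynomial.coeff_monomial]
  apply_of_ne a b x hab := by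
    classical
    simp [monomialProjection_apply, MvPolynomial.coeff_monomial, hab.symm]
  add_smul e a x := by
    simp [monomialProjection_apply, MvPolynomial.monomial_mul]
  smul_of_not_le e a x hea := by
    simp [monomialProjection_apply, MvPolynomial.coeff_monomial_mul', hea]

variable {M : Ideal (MvPolynomial σ k)}

theorem IsMinimallyGeneratedBy.monomialProjection_mem {q : ℕ} {g : Fin q → σ →₀ ℕ}
    (hM : IsMinimallyGeneratedBy M g) (a : σ →₀ ℕ) {x : MvPolynomial σ k} (hx : x ∈ M) :
    monomialProjection k a x ∈ M := by
  rw [monomialProjection_apply]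
  by_cases h : x.coeff a = 0
  · rw [h, map_zero]
    exact zero_mem _
  · exact (hM.monomial_mem_iff h).mpr (hM.mem_iff.mp hx a (MvPolynomial.mem_support_iff.mpr h))

/-- The multigrading of an ideal that is stable under the projections to monomials. -/
noncomputable def idealProjection
    (hM : ∀ a, ∀ x ∈ M, monomialProjection k a x ∈ M) (a : σ →₀ ℕ) : M →ₗ[k] M :=
  (monomialProjection k a).restrict (p := M.restrictScalars k) (q := M.restrictScalars k) (hM a)

theorem isMultigradedProjection_idealProjection
    (hM : ∀ a, ∀ x ∈ M, monomialProjection k a x ∈ M) :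
    IsMultigradedProjection (idealProjection hM) where
  apply_self a x := Subtype.ext (isMultigradedProjection_monomialProjection.apply_self a x.1)
  apply_of_ne a b x hab :=
    Subtype.ext (isMultigradedProjection_monomialProjection.apply_of_ne a b x.1 hab)
  add_smul e a x := Subtype.ext (isMultigradedProjection_monomialProjection.add_smul e a x.1)
  smul_of_not_le e a x hea :=
    Subtype.ext (isMultigradedProjection_monomialProjection.smul_of_not_le e a x.1 hea)

theorem range_idealProjection (hM : ∀ a, ∀ x ∈ M, monomialProjection k a x ∈ M) (a : σ →₀ ℕ) :
    LinearMap.range (idealProjection hM a) = idealComponent M a := by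
  ext x
  constructor
  · rintro ⟨y, rfl⟩
    exact ⟨y.1.coeff a, rfl⟩
  · rintro ⟨c, hc⟩
    refine ⟨x, Subtype.ext ?_⟩
    change MvPolynomial.monomial a (x.1.coeff a) = x.1
    have hc' : MvPolynomial.monomial a c = x.1 := hc
    classical
    rw [← hc', MvPolynomial.coeff_monomial, if_pos rfl]

/-- The multigrading of the quotient by an ideal that is stable under the projections to
monomials. -/
noncomputable def quotientProjection
    (hM : ∀ a, ∀ x ∈ M, monomialProjection k a x ∈ M) (a : σ →₀ ℕ) :
    (MvPolynomial σ k ⧸ M) →ₗ[k] (MvPolynomial σ k ⧸ M) :=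
  Submodule.mapQ (M.restrictScalars k) (M.restrictScalars k) (monomialProjection k a) (hM a)

theorem quotientProjection_mk (hM : ∀ a, ∀ x ∈ M, monomialProjection k a x ∈ M) (a : σ →₀ ℕ)
    (x : MvPolynomial σ k) : quotientProjection hM a (Ideal.Quotient.mk M x) =
      Ideal.Quotient.mk M (monomialProjection k a x) := rfl

theorem isMultigradedProjection_quotientProjection
    (hM : ∀ a, ∀ x ∈ M, monomialProjection k a x ∈ M) :
    IsMultigradedProjection (quotientProjection hM) where
  apply_self a x := by
    obtain ⟨x, rfl⟩ := Ideal.Quotient.mk_surjective x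
    simp only [quotientProjection_mk, isMultigradedProjection_monomialProjection.apply_self]
  apply_of_ne a b x hab := by
    obtain ⟨x, rfl⟩ := Ideal.Quotient.mk_surjective x
    simp only [quotientProjection_mk,
      isMultigradedProjection_monomialProjection.apply_of_ne a b x hab, map_zero]
  add_smul e a x := by
    obtain ⟨x, rfl⟩ := Ideal.Quotient.mk_surjective x
    exact congrArg (Ideal.Quotient.mk M)
      (isMultigradedProjection_monomialProjection.add_smul e a x)
  smul_of_not_le e a x hea := by
    obtain ⟨x, rfl⟩ := Ideal.Quotient.mk_surjective x
    exact (congrArg (Ideal.Quotient.mk M)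
      (isMultigradedProjection_monomialProjection.smul_of_not_le e a x hea)).trans (map_zero _)

theorem quotientComponent_eq_span (M : Ideal (MvPolynomial σ k)) (a : σ →₀ ℕ) :
    quotientComponent M a = Submodule.span k {Ideal.Quotient.mk M (MvPolynomial.monomial a 1)} := by
  ext x
  rw [Submodule.mem_span_singleton]
  have h (c : k) : c • Ideal.Quotient.mk M (MvPolynomial.monomial a 1) =
      Ideal.Quotient.mk M (MvPolynomial.monomial a c) := by
    rw [← mul_one c, ← smul_eq_mul, ← MvPolynomial.smul_monomial, smul_eq_mul, mul_one]
    rfl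
  simp only [h]
  constructor
  · rintro ⟨_, ⟨c, rfl⟩, rfl⟩
    exact ⟨c, rfl⟩
  · rintro ⟨c, rfl⟩
    exact ⟨_, ⟨c, rfl⟩, rfl⟩

theorem range_quotientProjection (hM : ∀ a, ∀ x ∈ M, monomialProjection k a x ∈ M)
    (a : σ →₀ ℕ) : LinearMap.range (quotientProjection hM a) = quotientComponent M a := by
  ext x
  constructor
  · rintro ⟨y, rfl⟩
    obtain ⟨y, rfl⟩ := Ideal.Quotient.mk_surjective y
    exact ⟨_, ⟨y.coeff a, rfl⟩, rfl⟩
  · rintro ⟨_, ⟨c, rfl⟩, rfl⟩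
    refine ⟨Ideal.Quotient.mk M (MvPolynomial.monomial a c), ?_⟩
    classical
    rw [quotientProjection_mk, monomialProjection_apply, MvPolynomial.coeff_monomial, if_pos rfl]
    rfl

open Classical in
theorem IsMinimallyGeneratedBy.finrank_quotientComponent {q : ℕ} {g : Fin q → σ →₀ ℕ}
    (hM : IsMinimallyGeneratedBy M g) (a : σ →₀ ℕ) :
    Module.finrank k (quotientComponent M a) = if ∃ j, g j ≤ a then 0 else 1 := by
  have hmem := hM.monomial_mem_iff (a := a) (one_ne_zero (α := k))
  rw [quotientComponent_eq_span]
  split_ifs with h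
  · rw [Ideal.Quotient.eq_zero_iff_mem.mpr (hmem.mpr h), Submodule.span_zero_singleton,
      finrank_bot]
  · exact finrank_span_singleton fun h0 => h (hmem.mp (Ideal.Quotient.eq_zero_iff_mem.mp h0))

open Classical in
theorem IsMinimallyGeneratedBy.finrank_idealComponent {q : ℕ} {g : Fin q → σ →₀ ℕ}
    (hM : IsMinimallyGeneratedBy M g) (a : σ →₀ ℕ) :
    Module.finrank k (idealComponent M a) = if ∃ j, g j ≤ a then 1 else 0 := by
  split_ifs with h
  · have hmem := (hM.monomial_mem_iff (a := a) (one_ne_zero (α := k))).mpr h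
    have : idealComponent M a = Submodule.span k {⟨MvPolynomial.monomial a 1, hmem⟩} := by
      ext x
      rw [Submodule.mem_span_singleton]
      refine exists_congr fun c => ?_
      rw [Subtype.ext_iff]
      change _ = x.1 ↔ c • MvPolynomial.monomial a (1 : k) = x.1
      rw [MvPolynomial.smul_monomial, smul_eq_mul, mul_one]
    rw [this]
    refine finrank_span_singleton fun h0 => ?_
    have := congrArg Subtype.val h0
    simp at this
  · have : idealComponent M a = ⊥ := by
      rw [eq_bot_iff]
      rintro x ⟨c, hc⟩
      have hc' : MvPolynomial.monomial a c = x.1 := hc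
      have hc0 : c = 0 := by
        by_contra hc0
        exact h ((hM.monomial_mem_iff hc0).mp (hc' ▸ x.2))
      rw [Submodule.mem_bot]
      exact Subtype.ext (by rw [← hc', hc0, map_zero]; rfl)
    rw [this, finrank_bot]

end MonomialIdeal

/-! ### Basis elements of minimal resolutions of monomial ideals -/

theorem mainTheorem4 {σ k : Type*} [Finite σ] [Field k] {q : ℕ} (M : Ideal (MvPolynomial σ k))
    (g : Fin q → σ →₀ ℕ) (hM : IsMinimallyGeneratedBy M g) (m : σ →₀ ℕ)
    (hm : ((taylorResolution k g).basisOfMultidegree m).Nonempty)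
    (A : Set (σ →₀ ℕ)) (hA : A = {a | a ∈ Set.range g ∧ a ≤ m})
    (hunion : A = ⋃ B ∈ minimalGenerators A m, (B : Set (σ →₀ ℕ)))
    (hdom : IsDominantFamily (minimalGenerators A m)) :
    Odd ((taylorResolution k g).basisOfMultidegree m).ncard ∧
      (∀ F : MultigradedFreeComplex σ k, F.IsMinimal → F.IsResolutionOf (quotientComponent M) →
        (F.basisOfMultidegree m).Nonempty) ∧
      (∀ F : MultigradedFreeComplex σ k, F.IsMinimal → F.IsResolutionOf (idealComponent M) →
        (F.basisOfMultidegree m).Nonempty) := by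
  classical
  have hAfin : A.Finite := by
    rw [hA]
    exact (Set.finite_range g).subset fun a ha => ha.1
  obtain ⟨A, rfl⟩ := hAfin.exists_finset_coe
  have hAm : ∀ a ∈ A, a ≤ m := fun a ha =>
    (hA.le (Finset.mem_coe.mpr ha) : a ∈ Set.range g ∧ a ≤ m).2
  have hodd : Odd (Finset.univ.filter fun s : Finset (Fin q) => s.sup g = m).card := by
    rw [card_filter_sup_eq hM.injective hA]
    exact odd_card_filter_isGeneratorOf hAm hunion hdom
  have hne := taylorEuler_ne_zero hodd
  have hstable := fun a x hx => hM.monomialProjection_mem (x := x) a hx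
  refine ⟨by rwa [ncard_basisOfMultidegree_taylorResolution], fun F hF hres => ?_,
    fun F hF hres => ?_⟩
  · simp only [← funext (range_quotientProjection hstable)] at hres
    refine F.basisOfMultidegree_nonempty (isMultigradedProjection_quotientProjection hstable) hF
      hres (u := taylorEuler g) (fun a => ?_) hne
    rw [sum_Iic_taylorEuler, range_quotientProjection, hM.finrank_quotientComponent]
    split_ifs <;> rfl
  · simp only [← funext (range_idealProjection hstable)] at hres
    -- As `M` is the kernel of `S → S ⧸ M` and `S` contributes only in multidegree `0 ≠ m`, the signed
    -- number for `M` in multidegree `m` is that for `S ⧸ M` up to sign.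
    refine F.basisOfMultidegree_nonempty (isMultigradedProjection_idealProjection hstable) hF
      hres (u := fun t => (if t = 0 then 1 else 0) - taylorEuler g t) (fun a => ?_) ?_
    · rw [Finset.sum_sub_distrib, sum_Iic_taylorEuler, range_idealProjection,
        hM.finrank_idealComponent, Finset.sum_ite_eq', if_pos (Finset.mem_Iic.mpr zero_le)]
      split_ifs <;> rfl
    · rw [if_neg (ne_zero_of_isDominantFamily hdom), zero_sub]
      exact neg_ne_zero.mpr hne
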